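/- Consider private information retrieval (PIR) with $N=2$ databases and $K=2$ messages. The messages $W_1,W_2$ are independent and uniformly distributed on $\mathcal X^L$, where $L\ge 1$ and $\mathcal X$ is a finite alphabet with $|\mathcal X|\ge 2$, and a random key $\mathsf F$, independent of the messages, is uniformly distributed on a finite non-empty set $\mathcal F$. A PIR code consists of, for $n\in\{1,2\}$: storage functions $\Phi_n:\mathcal X^{2L}\to\mathcal S_n$ with $\mathcal S_n$ finite, giving the stored contents $S_n=\Phi_n(W_1,W_2)$; query functions $\phi_n:\{1,2\}\times\mathcal F\to\mathcal Q_n$, giving the queries $Q_n^{[k]}=\phi_n(k,\mathsf F)$; answer length functions $\ell_n:\mathcal Q_n\to\{0,1,2,\dots\}$; answer functions $\varphi_n$ that assign to $q\in\mathcal Q_n$ and $s\in\mathcal S_n$ a vector $\varphi_n(q,s)\in\mathcal Y^{\ell_n(q)}$ over a finite alphabet $\mathcal Y$, giving the answers $A_n^{[k]}=\varphi_n(Q_n^{[k]},S_n)$; and a reconstruction function $\psi$. It is required that $\psi(A_1^{[k]},A_2^{[k]},k,\mathsf F)=W_k$ for $k=1,2$ (correctness) and that $\Pr(Q_n^{[1]}=q)=\Pr(Q_n^{[2]}=q)$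 for $n=1,2$ and all $q\in\mathcal Q_n$ (privacy). The per-node storage cost and the per-node download cost are $$\alpha=\frac12\sum_{n=1}^{2}\frac{\log_2|\mathcal S_n|}{L\log_2|\mathcal X|},\qquad \beta=\frac12\sum_{n=1}^{2}\frac{\log_2|\mathcal Y|\;\mathbb E\big[\ell_n(Q_n^{[k]})\big]}{L\log_2|\mathcal X|},$$ where, by privacy, $\beta$ does not depend on $k\in\{1,2\}$. Then every such PIR code satisfies $$3\alpha+8\beta\ge 10 .$$ -/

import Mathlib

/-- An `N`-server private information retrieval (PIR) storage code for `K` messages, each a vector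
of `L` symbols of the alphabet `X`.  `Y` is the alphabet of the coded symbols in the answers, `F`
the finite set on which the user's random key is uniformly distributed, `S n` the set of possible
contents of database `n`, and `Q n` the set of queries that server `n` accommodates.

The messages are independent and uniform on `Fin L → X` and independent of the key, so that every
pair (messages, key) has positive probability; hence `correct`, the equality of the random
variables `Ŵ_k = W_k`, is an equality for all messages and all keys. -/
structure PIRCode (N K L : ℕ) (X Y F : Type*) [Fintype F] [Nonempty F]
    (S Q : Fin N → Type*) where
  /-- The storage encoding functions. -/
  store : (n : Fin N) → (Fin K → Fin L → X) → S n
  /-- The query functions: index of the desired message and key to query. -/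
  query : (n : Fin N) → Fin K → F → Q n
  /-- The answer lengths, functions of the query only. -/
  len : (n : Fin N) → Q n → ℕ
  /-- The answer functions. -/
  answer : (n : Fin N) → (q : Q n) → S n → (Fin (len n q) → Y)
  /-- The reconstruction function, given the message index, the key and the answers. The index and
  the key determine the queries, hence the lengths of the answers. -/
  decode : (k : Fin K) → (f : F) → ((n : Fin N) → Fin (len n (query n k f)) → Y) → (Fin L → X)
  /-- Correctness. -/
  correct : ∀ (k : Fin K) (f : F) (W : Fin K → Fin L → X),
    decode k f (fun n => answer n (query n k f) (store n W)) = W k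
  /-- Privacy: the law of the query to each server does not depend on the desired message. -/
  privacy : ∀ (k k' : Fin K) (n : Fin N) (q : Q n),
    (PMF.uniformOfFintype F).map (query n k) q = (PMF.uniformOfFintype F).map (query n k') q

namespace PIRCode

variable {N K L : ℕ} {X Y F : Type*} [Fintype F] [Nonempty F] {S Q : Fin N → Type*}

/-- The expected length of the answer of server `n` when message `k` is requested. -/
noncomputable def expectedLength (C : PIRCode N K L X Y F S Q) (n : Fin N) (k : Fin K) : ℝ :=
  ∑ f : F, (PMF.uniformOfFintype F f).toReal * (C.len n (C.query n k f) : ℝ)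

/-- The operational normalized storage cost of database `n`. -/
noncomputable def storageCostAt [Fintype X] [∀ n, Fintype (S n)]
    (_C : PIRCode N K L X Y F S Q) (n : Fin N) : ℝ :=
  Real.logb 2 (Fintype.card (S n)) / (L * Real.logb 2 (Fintype.card X))

/-- The average (per node) operational storage cost `α`. -/
noncomputable def storageCost [Fintype X] [∀ n, Fintype (S n)]
    (C : PIRCode N K L X Y F S Q) : ℝ :=
  (1 / N) * ∑ n : Fin N, C.storageCostAt n

/-- The operational normalized download cost of database `n` when message `k` is requested. -/
noncomputable def downloadCostAt [Fintype X] [Fintype Y]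
    (C : PIRCode N K L X Y F S Q) (n : Fin N) (k : Fin K) : ℝ :=
  (Real.logb 2 (Fintype.card Y) * C.expectedLength n k) / (L * Real.logb 2 (Fintype.card X))

/-- The average (per node) operational download cost `β` when message `k` is requested.
By privacy it takes the same value for every `k`. -/
noncomputable def downloadCost [Fintype X] [Fintype Y]
    (C : PIRCode N K L X Y F S Q) (k : Fin K) : ℝ :=
  (1 / N) * ∑ n : Fin N, C.downloadCostAt n k

end PIRCode

/-! With a uniform key, privacy says that the queries to a database for the two messages differ by a
permutation of the keys. Hence every query made for one message also occurs for the other, and each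
key starts a chain of answers x₀, y₁, x₂, y₃, x₄, alternately from databases i and j, whose
consecutive pairs decode W₁, W₂, W₁, W₂ (`sum_entropy_chain`).

Storage enters through `entropy_chain`. Adjoin a copy P of W₂, conditionally independent of
everything given S_j, and a copy Q of W₁, conditionally independent of everything given S_i. Since x
is a function of S_i and y of S_j, H(x,Q) = H(x,W₁) and H(y,P) = H(y,W₂). The joint entropy of
messages, P and Q is computed by `entropy_condCopy` and bounded by `entropy_chain_shannon`.

Averaged over the key, the terms H(x,W₁) cancel; adding the inequality with the databases exchanged
cancels the remaining H(x,W₂) and H(y,W₂). Bounding the other entropies by log-cardinalities leaves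
20 ≤ 6α + 16β. -/

open Finset

/-! ### Entropy on finite probability spaces. -/

section Entropy

variable {Ω Ω' α β γ δ : Type*} [Fintype Ω] [Fintype Ω']

open Classical in
/-- The probability, under the weights `p`, of the event that `A` takes the value it has at `ω`. -/
noncomputable def levelProb (p : Ω → ℝ) (A : Ω → α) (ω : Ω) : ℝ :=
  ∑ ω', if A ω' = A ω then p ω' else 0

/-- The Shannon entropy (in nats) of the random variable `A` on a finite probability space. -/
noncomputable def entropy (p : Ω → ℝ) (A : Ω → α) : ℝ :=
  -∑ ω, p ω * Real.log (levelProb p A ω)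

lemma levelProb_congr (p : Ω → ℝ) (A : Ω → α) {x y : Ω} (h : A x = A y) :
    levelProb p A x = levelProb p A y := by
  refine sum_congr rfl fun z _ => ?_
  by_cases hz : A z = A x
  · rw [if_pos hz, if_pos (hz.trans h)]
  · rw [if_neg hz, if_neg fun hy => hz (hy.trans h.symm)]

lemma levelProb_nonneg {p : Ω → ℝ} (hp : ∀ ω, 0 ≤ p ω) (A : Ω → α) (ω : Ω) :
    0 ≤ levelProb p A ω := by
  classical
  exact sum_nonneg fun i _ => by split_ifs <;> simp [hp]

lemma le_levelProb {p : Ω → ℝ} (hp : ∀ ω, 0 ≤ p ω) (A : Ω → α) (ω : Ω) :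
    p ω ≤ levelProb p A ω := by
  classical
  have := single_le_sum (f := fun ω' => if A ω' = A ω then p ω' else 0)
    (fun i _ => by split_ifs <;> simp [hp]) (mem_univ ω)
  simpa [levelProb] using this

lemma levelProb_mono {p : Ω → ℝ} (hp : ∀ ω, 0 ≤ p ω) {A : Ω → α} {C : Ω → γ} {ω : Ω}
    (h : ∀ x, p x ≠ 0 → A x = A ω → C x = C ω) : levelProb p A ω ≤ levelProb p C ω := by
  classical
  refine sum_le_sum fun x _ => ?_
  by_cases hx : p x = 0
  · simp [hx]
  · by_cases hA : A x = A ω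
    · simp [hA, h x hx hA]
    · rw [if_neg hA]; split_ifs <;> simp [hp]

/-- Only outcomes of positive weight matter; this is needed for coupled copies, which agree on the
shared variable only on the support. -/
lemma entropy_mono {p : Ω → ℝ} (hp : ∀ ω, 0 ≤ p ω) {A : Ω → α} {C : Ω → γ}
    (h : ∀ x y, p x ≠ 0 → p y ≠ 0 → A x = A y → C x = C y) : entropy p C ≤ entropy p A := by
  refine neg_le_neg (sum_le_sum fun ω _ => ?_)
  by_cases hω : p ω = 0
  · simp [hω]
  · refine mul_le_mul_of_nonneg_left (Real.log_le_log ?_ ?_) (hp ω)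
    · exact ((hp ω).lt_of_ne' hω).trans_le (le_levelProb hp A ω)
    · exact levelProb_mono hp fun x hx hA => h x ω hx hω hA

lemma entropy_congr {p : Ω → ℝ} (hp : ∀ ω, 0 ≤ p ω) {A : Ω → α} {C : Ω → γ}
    (h : ∀ x y, p x ≠ 0 → p y ≠ 0 → (A x = A y ↔ C x = C y)) : entropy p A = entropy p C :=
  le_antisymm (entropy_mono hp fun x y hx hy => (h x y hx hy).2)
    (entropy_mono hp fun x y hx hy => (h x y hx hy).1)

/-- Summing `p / levelProb p A` over a set on which `A` is constant gives at most `1`. -/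
lemma sum_div_levelProb_le_one {p : Ω → ℝ} (hp : ∀ ω, 0 ≤ p ω) (A : Ω → α) (s : Finset Ω)
    (hs : ∀ x ∈ s, ∀ y ∈ s, A x = A y) : ∑ ω ∈ s, p ω / levelProb p A ω ≤ 1 := by
  classical
  rcases s.eq_empty_or_nonempty with rfl | ⟨z, hz⟩
  · simp
  have h1 : ∀ ω ∈ s, p ω / levelProb p A ω = p ω / levelProb p A z := fun ω hω => by
    rw [levelProb_congr p A (hs ω hω z hz)]
  rw [sum_congr rfl h1, ← sum_div]
  refine div_le_one_of_le₀ ?_ (levelProb_nonneg hp A z)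
  calc ∑ ω ∈ s, p ω = ∑ ω ∈ s, if A ω = A z then p ω else 0 :=
        sum_congr rfl fun ω hω => by rw [if_pos (hs ω hω z hz)]
    _ ≤ levelProb p A z := sum_le_sum_of_subset_of_nonneg (subset_univ s)
        fun i _ _ => by split_ifs <;> simp [hp]

/-- P_A·P_B/P_C is the joint law making A and B conditionally independent given C. The factor p/P_AB
counts each attained value of (A, B) at most once, so the sum is at most the total mass of that law.
-/
lemma sum_mul_levelProb_le_one {p : Ω → ℝ} (hp : p ∈ stdSimplex ℝ Ω) {A : Ω → α} {B : Ω → β}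
    {C : Ω → γ} (hA : ∀ x y, A x = A y → C x = C y) (hB : ∀ x y, B x = B y → C x = C y) :
    ∑ ω, p ω * (levelProb p A ω * levelProb p B ω /
      (levelProb p C ω * levelProb p (fun x => (A x, B x)) ω)) ≤ 1 := by
  classical
  have h0 := hp.1
  set AB : Ω → α × β := fun x => (A x, B x)
  have e : ∀ ω, p ω * (levelProb p A ω * levelProb p B ω / (levelProb p C ω * levelProb p AB ω)) =
      ∑ x, ∑ y, if A x = A ω ∧ B y = B ω then
        p x * p y / levelProb p C x * (p ω / levelProb p AB ω) else 0 := by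
    intro ω
    have : levelProb p A ω * levelProb p B ω / levelProb p C ω =
        ∑ x, ∑ y, if A x = A ω ∧ B y = B ω then p x * p y / levelProb p C x else 0 := by
      conv_lhs => rw [levelProb, levelProb, sum_mul_sum, sum_div]
      refine sum_congr rfl fun x _ => ?_
      rw [sum_div]
      refine sum_congr rfl fun y _ => ?_
      by_cases h1 : A x = A ω
      · by_cases h2 : B y = B ω
        · simp [h1, h2, levelProb_congr p C (hA x ω h1)]
        · simp [h2]
      · simp [h1]
    rw [show p ω * (levelProb p A ω * levelProb p B ω / (levelProb p C ω * levelProb p AB ω)) =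
      (levelProb p A ω * levelProb p B ω / levelProb p C ω) * (p ω / levelProb p AB ω) by
        rw [div_mul_eq_div_div]; ring, this, sum_mul]
    refine sum_congr rfl fun x _ => ?_
    rw [sum_mul]
    exact sum_congr rfl fun y _ => by split_ifs <;> simp
  calc _ = ∑ ω, ∑ x, ∑ y, if A x = A ω ∧ B y = B ω then
        p x * p y / levelProb p C x * (p ω / levelProb p AB ω) else 0 :=
        sum_congr rfl fun ω _ => e ω
    _ = ∑ x, ∑ y, ∑ ω, if A x = A ω ∧ B y = B ω then
        p x * p y / levelProb p C x * (p ω / levelProb p AB ω) else 0 := by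
        rw [sum_comm]; exact sum_congr rfl fun x _ => sum_comm
    _ ≤ ∑ x, ∑ y, if C y = C x then p x * p y / levelProb p C x else 0 := by
        refine sum_le_sum fun x _ => sum_le_sum fun y _ => ?_
        have hn : 0 ≤ p x * p y / levelProb p C x :=
          div_nonneg (mul_nonneg (h0 x) (h0 y)) (levelProb_nonneg h0 C x)
        rw [← sum_filter, ← mul_sum]
        split_ifs with hC
        · refine mul_le_of_le_one_right hn (sum_div_levelProb_le_one h0 AB _ ?_)
          intro u hu v hv
          simp only [mem_filter, mem_univ, true_and] at hu hv
          exact Prod.ext (hu.1.symm.trans hv.1) (hu.2.symm.trans hv.2)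
        · rw [filter_eq_empty_iff.2, sum_empty, mul_zero]
          rintro ω - ⟨h1, h2⟩
          exact hC ((hB y ω h2).trans (hA x ω h1).symm)
    _ = ∑ x, p x * (levelProb p C x / levelProb p C x) := by
        refine sum_congr rfl fun x _ => ?_
        conv_rhs => rw [levelProb, sum_div, mul_sum]
        refine sum_congr rfl fun y _ => ?_
        split_ifs <;> simp [levelProb, mul_div_assoc]
    _ ≤ ∑ x, p x := sum_le_sum fun x _ => mul_le_of_le_one_right (h0 x) (div_self_le_one _)
    _ = 1 := hp.2

/-- Submodularity of entropy: if `C` is a function of `A` and a function of `B`, and `D` is a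
function of the pair `(A, B)`, then `H(C) + H(D) ≤ H(A) + H(B)`. -/
theorem entropy_submodular {p : Ω → ℝ} (hp : p ∈ stdSimplex ℝ Ω) {A : Ω → α} {B : Ω → β}
    {C : Ω → γ} {D : Ω → δ} (hA : ∀ x y, A x = A y → C x = C y)
    (hB : ∀ x y, B x = B y → C x = C y) (hD : ∀ x y, A x = A y → B x = B y → D x = D y) :
    entropy p C + entropy p D ≤ entropy p A + entropy p B := by
  have h0 := hp.1
  set AB : Ω → α × β := fun x => (A x, B x) with hAB
  have hD' : entropy p D ≤ entropy p AB :=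
    entropy_mono h0 fun x y _ _ h => hD x y (congrArg Prod.fst h) (congrArg Prod.snd h)
  refine (add_le_add_right hD' _).trans ?_
  -- Gibbs' inequality: log u ≤ u − 1 at u = P_A·P_B/(P_C·P_AB), weighted by p.
  have key : ∀ ω, p ω - p ω * (levelProb p A ω * levelProb p B ω /
      (levelProb p C ω * levelProb p AB ω)) ≤ p ω * Real.log (levelProb p C ω) +
      p ω * Real.log (levelProb p AB ω) - p ω * Real.log (levelProb p A ω) -
      p ω * Real.log (levelProb p B ω) := by
    intro ω
    rcases (h0 ω).eq_or_lt with h | h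
    · simp [← h]
    have a := h.trans_le (le_levelProb h0 A ω)
    have b := h.trans_le (le_levelProb h0 B ω)
    have c := h.trans_le (le_levelProb h0 C ω)
    have d := h.trans_le (le_levelProb h0 AB ω)
    have := Real.log_le_sub_one_of_pos (div_pos (mul_pos a b) (mul_pos c d))
    rw [Real.log_div (mul_pos a b).ne' (mul_pos c d).ne', Real.log_mul a.ne' b.ne',
      Real.log_mul c.ne' d.ne'] at this
    nlinarith
  have hs := sum_le_sum fun ω (_ : ω ∈ univ) => key ω
  have h1 := sum_mul_levelProb_le_one hp hA hB
  simp only [sum_sub_distrib, sum_add_distrib, hp.2] at hs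
  simp only [entropy]
  linarith

lemma entropy_add_le {p : Ω → ℝ} (hp : p ∈ stdSimplex ℝ Ω) (A : Ω → α) (B : Ω → β) :
    entropy p (fun x => (A x, B x)) ≤ entropy p A + entropy p B := by
  have h := entropy_submodular hp (A := A) (B := B) (C := fun _ => ()) (D := fun x => (A x, B x))
    (fun _ _ _ => rfl) (fun _ _ _ => rfl) fun x y h1 h2 => by simp [h1, h2]
  have : entropy p (fun _ : Ω => ()) = 0 := by simp [entropy, levelProb, hp.2]
  linarith

lemma entropy_le_log_card [Fintype α] {p : Ω → ℝ} (hp : p ∈ stdSimplex ℝ Ω) (A : Ω → α) :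
    entropy p A ≤ Real.log (Fintype.card α) := by
  classical
  have h0 := hp.1
  obtain ⟨ω₀⟩ : Nonempty Ω := by
    by_contra h
    rw [not_nonempty_iff] at h
    simpa using hp.2
  have hn : (0 : ℝ) < Fintype.card α := Nat.cast_pos.2 (Fintype.card_pos_iff.2 ⟨A ω₀⟩)
  -- Gibbs' inequality against the uniform law on `α`.
  have key : ∀ ω, -(p ω * Real.log (levelProb p A ω)) ≤
      p ω * Real.log (Fintype.card α) + (p ω / levelProb p A ω) / Fintype.card α - p ω := by
    intro ω
    rcases (h0 ω).eq_or_lt with h | h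
    · simp [← h]
    have a := h.trans_le (le_levelProb h0 A ω)
    have := Real.log_le_sub_one_of_pos (inv_pos.2 (mul_pos a hn))
    rw [Real.log_inv, Real.log_mul a.ne' hn.ne'] at this
    have e : (p ω / levelProb p A ω) / Fintype.card α =
      p ω * (levelProb p A ω * Fintype.card α)⁻¹ := by rw [div_div, div_eq_mul_inv]
    rw [e]
    nlinarith
  have hc : ∑ ω, p ω / levelProb p A ω ≤ Fintype.card α := by
    rw [← sum_fiberwise univ A]
    calc _ ≤ ∑ _a : α, (1 : ℝ) := sum_le_sum fun a _ => sum_div_levelProb_le_one h0 A _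
          fun x hx y hy => by simp_all
      _ = _ := by simp
  have hs := sum_le_sum fun ω (_ : ω ∈ univ) => key ω
  simp only [sum_sub_distrib, sum_add_distrib, hp.2, ← sum_mul, ← sum_div, sum_neg_distrib] at hs
  have : (∑ ω, p ω / levelProb p A ω) / Fintype.card α ≤ 1 := (div_le_one hn).2 hc
  simp only [entropy]
  linarith

/-- Entropy is computed in the image of a measure preserving map. -/
lemma entropy_comp {p : Ω → ℝ} {p' : Ω' → ℝ} (φ : Ω' → Ω)
    (h : ∀ g : Ω → ℝ, ∑ x, p' x * g (φ x) = ∑ ω, p ω * g ω) (A : Ω → α) :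
    entropy p' (fun x => A (φ x)) = entropy p A := by
  classical
  have hl : ∀ x, levelProb p' (fun x => A (φ x)) x = levelProb p A (φ x) := by
    intro x
    simpa [levelProb] using h fun ω => if A ω = A (φ x) then 1 else 0
  simp only [entropy, hl]
  rw [h fun ω => Real.log (levelProb p A ω)]

/-! ### Conditionally independent copies. -/

open Classical in
/-- Two copies of a finite probability space, coupled so that they agree on `S` and are
conditionally independent given `S`. -/
noncomputable def condCopy (p : Ω → ℝ) (S : Ω → γ) : Ω × Ω → ℝ := fun z =>
  if S z.2 = S z.1 then p z.1 * p z.2 / levelProb p S z.1 else 0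

lemma condCopy_support {p : Ω → ℝ} {S : Ω → γ} {z : Ω × Ω} (hz : condCopy p S z ≠ 0) :
    S z.2 = S z.1 := by
  by_contra h
  exact hz (by simp [condCopy, h])

lemma condCopy_nonneg {p : Ω → ℝ} (hp : ∀ ω, 0 ≤ p ω) (S : Ω → γ) (z : Ω × Ω) :
    0 ≤ condCopy p S z := by
  unfold condCopy
  split_ifs
  · exact div_nonneg (mul_nonneg (hp _) (hp _)) (levelProb_nonneg hp S _)
  · exact le_rfl

lemma condCopy_swap (p : Ω → ℝ) (S : Ω → γ) (x y : Ω) :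
    condCopy p S (x, y) = condCopy p S (y, x) := by
  unfold condCopy
  by_cases h : S y = S x
  · simp only [h, if_true, levelProb_congr p S h, mul_comm]
  · simp [h, Ne.symm h]

lemma mul_levelProb_div_self {p : Ω → ℝ} (hp : ∀ ω, 0 ≤ p ω) (S : Ω → γ) (ω : Ω) :
    p ω * levelProb p S ω / levelProb p S ω = p ω := by
  rcases (hp ω).eq_or_lt with h | h
  · simp [← h]
  · exact mul_div_cancel_right₀ _ (h.trans_le (le_levelProb hp S ω)).ne'

lemma sum_condCopy_right {p : Ω → ℝ} (hp : ∀ ω, 0 ≤ p ω) (S : Ω → γ) (x : Ω) :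
    ∑ y, condCopy p S (x, y) = p x := by
  classical
  rw [← mul_levelProb_div_self hp S x]
  conv_rhs => rw [levelProb, mul_sum, sum_div]
  exact sum_congr rfl fun y _ => by simp only [condCopy, mul_ite, mul_zero, ite_div, zero_div]; rfl

lemma sum_condCopy_fst {p : Ω → ℝ} (hp : ∀ ω, 0 ≤ p ω) (S : Ω → γ) (g : Ω → ℝ) :
    ∑ z, condCopy p S z * g z.1 = ∑ ω, p ω * g ω := by
  rw [Fintype.sum_prod_type]
  refine sum_congr rfl fun x _ => ?_
  rw [← sum_condCopy_right hp S x, sum_mul]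

lemma sum_condCopy_snd {p : Ω → ℝ} (hp : ∀ ω, 0 ≤ p ω) (S : Ω → γ) (g : Ω → ℝ) :
    ∑ z, condCopy p S z * g z.2 = ∑ ω, p ω * g ω := by
  rw [Fintype.sum_prod_type, sum_comm]
  refine sum_congr rfl fun x _ => ?_
  simp only [condCopy_swap p S _ x]
  rw [← sum_mul, sum_condCopy_right hp]

lemma condCopy_mem_stdSimplex {p : Ω → ℝ} (hp : p ∈ stdSimplex ℝ Ω) (S : Ω → γ) :
    condCopy p S ∈ stdSimplex ℝ (Ω × Ω) :=
  ⟨condCopy_nonneg hp.1 S, by simpa [hp.2] using sum_condCopy_fst hp.1 S fun _ => 1⟩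

lemma entropy_condCopy_fst {p : Ω → ℝ} (hp : ∀ ω, 0 ≤ p ω) (S : Ω → γ) (A : Ω → α) :
    entropy (condCopy p S) (fun z => A z.1) = entropy p A :=
  entropy_comp Prod.fst (sum_condCopy_fst hp S) A

lemma entropy_condCopy_snd {p : Ω → ℝ} (hp : ∀ ω, 0 ≤ p ω) (S : Ω → γ) (A : Ω → α) :
    entropy (condCopy p S) (fun z => A z.2) = entropy p A :=
  entropy_comp Prod.snd (sum_condCopy_snd hp S) A

/-- In the conditional copy over `S`, the two copies are independent given `S`. -/
theorem entropy_condCopy {p : Ω → ℝ} (hp : ∀ ω, 0 ≤ p ω) {S : Ω → γ} {U : Ω → α} (V : Ω → β)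
    (hU : ∀ x y, U x = U y → S x = S y) :
    entropy (condCopy p S) (fun z => (U z.1, V z.2)) =
      entropy p U + entropy p (fun x => (S x, V x)) - entropy p S := by
  classical
  -- On the support the joint law factors as P_U·P_(S,V)/P_S, because `U` determines `S` and both
  -- copies share its value.
  have hl : ∀ z, condCopy p S z ≠ 0 → levelProb (condCopy p S) (fun z => (U z.1, V z.2)) z =
      levelProb p U z.1 * levelProb p (fun x => (S x, V x)) z.2 / levelProb p S z.1 := by
    intro z hz
    have hS := condCopy_support hz
    conv_lhs => rw [levelProb, Fintype.sum_prod_type]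
    conv_rhs => rw [levelProb, levelProb, sum_mul_sum, sum_div]
    refine sum_congr rfl fun x _ => ?_
    rw [sum_div]
    refine sum_congr rfl fun y _ => ?_
    by_cases h1 : U x = U z.1
    · have h3 := hU _ _ h1
      by_cases h2 : V y = V z.2
      · by_cases h4 : S y = S z.1 <;> simp [condCopy, h1, h2, h3, h4, hS, levelProb_congr p S h3]
      · simp [h2]
    · simp [h1]
  have key : ∀ z, condCopy p S z *
      Real.log (levelProb (condCopy p S) (fun z => (U z.1, V z.2)) z) =
      condCopy p S z * Real.log (levelProb p U z.1) +
      condCopy p S z * Real.log (levelProb p (fun x => (S x, V x)) z.2) -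
      condCopy p S z * Real.log (levelProb p S z.1) := by
    intro z
    by_cases hz : condCopy p S z = 0
    · simp [hz]
    have h1 : p z.1 ≠ 0 := fun h => hz (by simp [condCopy, h])
    have h2 : p z.2 ≠ 0 := fun h => hz (by simp [condCopy, h])
    have q1 := (hp z.1).lt_of_ne' h1
    have q2 := (hp z.2).lt_of_ne' h2
    have a := q1.trans_le (le_levelProb hp U z.1)
    have b := q2.trans_le (le_levelProb hp (fun x => (S x, V x)) z.2)
    have c := q1.trans_le (le_levelProb hp S z.1)
    rw [hl z hz, Real.log_div (mul_pos a b).ne' c.ne', Real.log_mul a.ne' b.ne']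
    ring
  simp only [entropy, key, sum_add_distrib, sum_sub_distrib]
  rw [sum_condCopy_fst hp S fun x => Real.log (levelProb p U x),
    sum_condCopy_snd hp S fun x => Real.log (levelProb p (fun x => (S x, V x)) x),
    sum_condCopy_fst hp S fun x => Real.log (levelProb p S x)]
  ring

/-- The copies agree on `S`, hence on `A`, so `A` may be read from the second copy, whose law is
`p`. -/
lemma entropy_condCopy_pair {p : Ω → ℝ} (hp : ∀ ω, 0 ≤ p ω) {S : Ω → γ} {A : Ω → α} (V : Ω → β)
    (hA : ∀ x y, S x = S y → A x = A y) :
    entropy (condCopy p S) (fun z => (A z.1, V z.2)) = entropy p (fun x => (A x, V x)) := by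
  rw [← entropy_condCopy_snd hp S fun x => (A x, V x)]
  refine entropy_congr (condCopy_nonneg hp S) fun x y hx hy => ?_
  rw [hA _ _ (condCopy_support hx), hA _ _ (condCopy_support hy)]

lemma entropy_condCopy_condCopy_fst {p : Ω → ℝ} (hp : p ∈ stdSimplex ℝ Ω) (S : Ω → γ)
    (T : Ω × Ω → δ) (A : Ω → α) :
    entropy (condCopy (condCopy p S) T) (fun z => A z.1.1) = entropy p A :=
  (entropy_condCopy_fst (condCopy_nonneg hp.1 S) T fun z => A z.1).trans
    (entropy_condCopy_fst hp.1 S A)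

end Entropy

/-! ### The entropy inequality for a chain of answers. -/

section Chain

variable {Ω Δ α₀ α₂ α₄ β₁ β₃ μ₁ μ₂ π κ σ τ : Type*} [Fintype Ω]

/-- The combination of Shannon inequalities behind the bound: answers `x₀, y₁, x₂, y₃, x₄` in which
consecutive ones alternately determine `w₁` and `w₂`, together with two further variables. -/
lemma entropy_chain_shannon {p : Ω → ℝ} (hp : p ∈ stdSimplex ℝ Ω) {D : Ω → Δ} {x₀ : Ω → α₀}
    {x₂ : Ω → α₂} {x₄ : Ω → α₄} {y₁ : Ω → β₁} {y₃ : Ω → β₃} {w₁ : Ω → μ₁} {w₂ : Ω → μ₂}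
    (P : Ω → π) (Q : Ω → κ) (hD : ∀ a b, w₁ a = w₁ b → w₂ a = w₂ b → D a = D b)
    (h01 : ∀ a b, x₀ a = x₀ b → y₁ a = y₁ b → w₁ a = w₁ b)
    (h12 : ∀ a b, x₂ a = x₂ b → y₁ a = y₁ b → w₂ a = w₂ b)
    (h23 : ∀ a b, x₂ a = x₂ b → y₃ a = y₃ b → w₁ a = w₁ b)
    (h34 : ∀ a b, x₄ a = x₄ b → y₃ a = y₃ b → w₂ a = w₂ b) :
    3 * entropy p (fun z => (D z, P z, Q z)) + entropy p P + entropy p Q + entropy p x₀ +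
        entropy p (fun z => (x₂ z, w₂ z)) + entropy p (fun z => (x₀ z, w₁ z)) ≤
      2 * entropy p (fun z => (x₀ z, y₁ z)) + entropy p x₂ + entropy p (fun z => (x₀ z, Q z)) +
        2 * entropy p (fun z => (x₂ z, Q z)) + entropy p (fun z => (x₄ z, Q z)) +
        2 * entropy p (fun z => (y₁ z, P z)) + 2 * entropy p (fun z => (y₃ z, P z)) := by
  have r1 : entropy p (fun z => (x₂ z, w₂ z, Q z)) ≤ entropy p (fun z => (x₂ z, y₁ z, Q z)) :=
    entropy_mono hp.1 fun a b _ _ h => by grind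
  have r2 := entropy_submodular hp (A := fun z => (x₂ z, P z, Q z))
    (B := fun z => (x₂ z, w₁ z, P z)) (C := fun z => (x₂ z, P z))
    (D := fun z => (x₂ z, w₁ z, P z, Q z)) (by grind) (by grind) (by grind)
  have r3 := entropy_submodular hp (A := fun z => (x₀ z, x₂ z, w₁ z, P z, Q z))
    (B := fun z => (x₀ z, y₁ z, P z, Q z)) (C := fun z => (x₀ z, w₁ z, P z, Q z))
    (D := fun z => (D z, P z, Q z)) (by grind) (by grind) (by grind)
  have r4 := entropy_submodular hp (A := fun z => (x₄ z, w₂ z, P z, Q z))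
    (B := fun z => (x₂ z, w₂ z, P z, Q z)) (C := fun z => (w₂ z, P z, Q z))
    (D := fun z => (x₂ z, x₄ z, w₂ z, P z, Q z)) (by grind) (by grind) (by grind)
  have r5 := entropy_submodular hp (A := fun z => (x₄ z, y₃ z, P z, Q z))
    (B := fun z => (x₂ z, x₄ z, w₂ z, P z, Q z)) (C := fun z => (x₄ z, w₂ z, P z, Q z))
    (D := fun z => (D z, P z, Q z)) (by grind) (by grind) (by grind)
  have r6 := entropy_submodular hp (A := fun z => (P z, Q z)) (B := fun z => (x₄ z, Q z))
    (C := Q) (D := fun z => (x₄ z, P z, Q z)) (by grind) (by grind) (by grind)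
  have r7 : entropy p (fun z => (x₂ z, w₁ z, P z)) ≤ entropy p (fun z => (x₂ z, y₃ z, P z)) :=
    entropy_mono hp.1 fun a b _ _ h => by grind
  have r8 := entropy_submodular hp (A := fun z => (x₂ z, Q z)) (B := fun z => (x₂ z, P z))
    (C := x₂) (D := fun z => (x₂ z, P z, Q z)) (by grind) (by grind) (by grind)
  have r9 := entropy_submodular hp (A := fun z => (x₂ z, Q z)) (B := fun z => (y₁ z, Q z))
    (C := Q) (D := fun z => (x₂ z, y₁ z, Q z)) (by grind) (by grind) (by grind)
  have r10 := entropy_submodular hp (A := fun z => (x₂ z, w₁ z, P z, Q z))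
    (B := fun z => (x₀ z, w₁ z, P z, Q z)) (C := fun z => (w₁ z, P z, Q z))
    (D := fun z => (x₀ z, x₂ z, w₁ z, P z, Q z)) (by grind) (by grind) (by grind)
  have r11 := entropy_submodular hp (A := fun z => (x₄ z, P z, Q z))
    (B := fun z => (y₃ z, P z, Q z)) (C := fun z => (P z, Q z))
    (D := fun z => (x₄ z, y₃ z, P z, Q z)) (by grind) (by grind) (by grind)
  have r12 := entropy_submodular hp (A := fun z => (x₂ z, P z)) (B := fun z => (y₁ z, P z))
    (C := P) (D := fun z => (x₂ z, y₁ z, P z)) (by grind) (by grind) (by grind)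
  have r13 := entropy_add_le hp y₃ Q
  have r14 := entropy_submodular hp (A := fun z => (y₃ z, P z)) (B := fun z => (x₂ z, P z))
    (C := P) (D := fun z => (x₂ z, y₃ z, P z)) (by grind) (by grind) (by grind)
  have r15 := entropy_submodular hp (A := fun z => (y₁ z, P z, Q z))
    (B := fun z => (x₀ z, y₁ z, Q z)) (C := fun z => (y₁ z, Q z))
    (D := fun z => (x₀ z, y₁ z, P z, Q z)) (by grind) (by grind) (by grind)
  have r16 := entropy_submodular hp (A := fun z => (x₀ z, Q z)) (B := fun z => (x₀ z, y₁ z))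
    (C := x₀) (D := fun z => (x₀ z, y₁ z, Q z)) (by grind) (by grind) (by grind)
  have r17 := entropy_submodular hp (A := fun z => (x₂ z, w₂ z, Q z))
    (B := fun z => (x₂ z, w₂ z, P z)) (C := fun z => (x₂ z, w₂ z))
    (D := fun z => (x₂ z, w₂ z, P z, Q z)) (by grind) (by grind) (by grind)
  have r18 := entropy_submodular hp (A := fun z => (y₃ z, Q z)) (B := fun z => (y₃ z, P z))
    (C := y₃) (D := fun z => (y₃ z, P z, Q z)) (by grind) (by grind) (by grind)
  have r19 : entropy p (fun z => (x₂ z, w₂ z, P z)) ≤ entropy p (fun z => (x₂ z, y₁ z, P z)) :=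
    entropy_mono hp.1 fun a b _ _ h => by grind
  have r20 := entropy_submodular hp (A := fun z => (P z, Q z)) (B := fun z => (y₁ z, P z))
    (C := P) (D := fun z => (y₁ z, P z, Q z)) (by grind) (by grind) (by grind)
  have r21 := entropy_submodular hp (A := fun z => (w₂ z, P z, Q z))
    (B := fun z => (w₁ z, P z, Q z)) (C := fun z => (P z, Q z))
    (D := fun z => (D z, P z, Q z)) (by grind) (by grind) (by grind)
  have r22 : entropy p (fun z => (x₀ z, w₁ z)) ≤ entropy p (fun z => (x₀ z, y₁ z)) :=
    entropy_mono hp.1 fun a b _ _ h => by grind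
  have r23 := entropy_add_le hp x₂ P
  -- Adding all the inequalities once, and `r23` twice, cancels every entropy absent from the
  -- conclusion. The three copies of H(D,P,Q) come from `r3`, `r5` and `r21`.
  linarith

/-- The entropy inequality for a chain of answers `x₀, y₁, x₂, y₃, x₄` computed alternately from
the storages `s` and `t`, where consecutive answers alternately determine `w₁` and `w₂`.
It is a non-Shannon inequality, obtained with a copy of `w₂` over `t` and one of `w₁` over `s`. -/
theorem entropy_chain {p : Ω → ℝ} (hp : p ∈ stdSimplex ℝ Ω) {x₀ : Ω → α₀}
    {x₂ : Ω → α₂} {x₄ : Ω → α₄} {y₁ : Ω → β₁} {y₃ : Ω → β₃} {w₁ : Ω → μ₁} {w₂ : Ω → μ₂}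
    {s : Ω → σ} {t : Ω → τ} (hw : ∀ a b, w₁ a = w₁ b → w₂ a = w₂ b → a = b)
    (hx₀ : ∀ a b, s a = s b → x₀ a = x₀ b) (hx₂ : ∀ a b, s a = s b → x₂ a = x₂ b)
    (hx₄ : ∀ a b, s a = s b → x₄ a = x₄ b) (hy₁ : ∀ a b, t a = t b → y₁ a = y₁ b)
    (hy₃ : ∀ a b, t a = t b → y₃ a = y₃ b)
    (h01 : ∀ a b, x₀ a = x₀ b → y₁ a = y₁ b → w₁ a = w₁ b)
    (h12 : ∀ a b, x₂ a = x₂ b → y₁ a = y₁ b → w₂ a = w₂ b)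
    (h23 : ∀ a b, x₂ a = x₂ b → y₃ a = y₃ b → w₁ a = w₁ b)
    (h34 : ∀ a b, x₄ a = x₄ b → y₃ a = y₃ b → w₂ a = w₂ b) :
    9 * entropy p (fun z => z) + entropy p w₁ + entropy p w₂ + entropy p x₀ +
        entropy p (fun z => (x₂ z, w₂ z)) + 3 * entropy p (fun z => (x₀ z, w₁ z)) +
        entropy p (fun z => (y₁ z, w₂ z)) ≤
      3 * entropy p s + 3 * entropy p t + 5 * entropy p (fun z => (x₀ z, y₁ z)) +
        3 * entropy p (fun z => (x₂ z, y₁ z)) + entropy p x₂ +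
        2 * entropy p (fun z => (x₂ z, w₁ z)) + entropy p (fun z => (x₄ z, w₁ z)) +
        2 * entropy p (fun z => (y₃ z, w₂ z)) := by
  set p₁ := condCopy p t with hp₁
  have hq₁ : p₁ ∈ stdSimplex ℝ (Ω × Ω) := condCopy_mem_stdSimplex hp t
  set s₁ : Ω × Ω → σ := fun z => s z.1 with hs₁
  set p₂ := condCopy p₁ s₁ with hp₂
  have hq₂ : p₂ ∈ stdSimplex ℝ ((Ω × Ω) × (Ω × Ω)) := condCopy_mem_stdSimplex hq₁ s₁
  have main := entropy_chain_shannon hq₂ (D := fun z => z.1.1) (x₀ := fun z => x₀ z.1.1)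
    (x₂ := fun z => x₂ z.1.1) (x₄ := fun z => x₄ z.1.1) (y₁ := fun z => y₁ z.1.1)
    (y₃ := fun z => y₃ z.1.1) (w₁ := fun z => w₁ z.1.1) (w₂ := fun z => w₂ z.1.1)
    (fun z => w₂ z.1.2) (fun z => w₁ z.2.1) (fun a b => hw _ _) (fun a b => h01 _ _)
    (fun a b => h12 _ _) (fun a b => h23 _ _) (fun a b => h34 _ _)
  -- Two applications of conditional independence: the copy of `w₂` given `t`, then the copy of `w₁`
  -- given `s`.
  have eD : entropy p₂ (fun z => (z.1.1, w₂ z.1.2, w₁ z.2.1)) = entropy p (fun z => z) +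
      entropy p (fun z => (t z, w₂ z)) - entropy p t +
      entropy p (fun z => (s z, w₁ z)) - entropy p s := by
    have h1 := entropy_condCopy hp.1 (S := t) (U := fun z => z) w₂ fun a b h => congrArg t h
    have h2 := entropy_condCopy hq₁.1 (S := s₁) (U := fun u => (u.1, w₂ u.2)) (fun u => w₁ u.1)
      fun a b h => show s a.1 = s b.1 from congrArg (fun u => s u.1) h
    rw [h1, entropy_condCopy_fst hp.1 t s,
      entropy_condCopy_fst hp.1 t fun x => (s x, w₁ x)] at h2
    rw [← h2]
    exact entropy_congr hq₂.1 fun a b _ _ => by grind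
  have eP : entropy p₂ (fun z => w₂ z.1.2) = entropy p w₂ :=
    (entropy_condCopy_fst hq₁.1 s₁ fun u => w₂ u.2).trans (entropy_condCopy_snd hp.1 t w₂)
  have eQ : entropy p₂ (fun z => w₁ z.2.1) = entropy p w₁ :=
    (entropy_condCopy_snd hq₁.1 s₁ fun u => w₁ u.1).trans (entropy_condCopy_fst hp.1 t w₁)
  have b1 := entropy_condCopy_condCopy_fst hp t s₁ x₀
  have b2 := entropy_condCopy_condCopy_fst hp t s₁ fun z => (x₂ z, w₂ z)
  have b3 := entropy_condCopy_condCopy_fst hp t s₁ fun z => (x₀ z, w₁ z)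
  have b4 := entropy_condCopy_condCopy_fst hp t s₁ fun z => (x₀ z, y₁ z)
  have b5 := entropy_condCopy_condCopy_fst hp t s₁ x₂
  have q0 := (entropy_condCopy_pair hq₁.1 (S := s₁) (A := fun u => x₀ u.1) (fun u => w₁ u.1)
    fun a b => hx₀ _ _).trans (entropy_condCopy_fst hp.1 t fun x => (x₀ x, w₁ x))
  have q2 := (entropy_condCopy_pair hq₁.1 (S := s₁) (A := fun u => x₂ u.1) (fun u => w₁ u.1)
    fun a b => hx₂ _ _).trans (entropy_condCopy_fst hp.1 t fun x => (x₂ x, w₁ x))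
  have q4 := (entropy_condCopy_pair hq₁.1 (S := s₁) (A := fun u => x₄ u.1) (fun u => w₁ u.1)
    fun a b => hx₄ _ _).trans (entropy_condCopy_fst hp.1 t fun x => (x₄ x, w₁ x))
  have c1 := (entropy_condCopy_fst hq₁.1 s₁ fun u => (y₁ u.1, w₂ u.2)).trans
    (entropy_condCopy_pair hp.1 (S := t) w₂ hy₁)
  have c3 := (entropy_condCopy_fst hq₁.1 s₁ fun u => (y₃ u.1, w₂ u.2)).trans
    (entropy_condCopy_pair hp.1 (S := t) w₂ hy₃)
  rw [eD, eP, eQ, b1, b2, b3, b4, b5, q0, q2, q4, c1, c3] at main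
  -- These bound H(t,w₂) and H(s,w₁) from below; each is used three times. In `k1`, `t` yields `y₃`,
  -- which with `x₂` decodes `w₁`; in `k2`, `s` yields `x₂`, which with `y₁` decodes `w₂`.
  have k1 := entropy_submodular hp (A := fun z => (t z, w₂ z)) (B := fun z => (x₂ z, y₁ z))
    (C := fun z => (y₁ z, w₂ z)) (D := fun z => z) (by grind) (by grind) (by grind)
  have k2 := entropy_submodular hp (A := fun z => (s z, w₁ z)) (B := fun z => (x₀ z, y₁ z))
    (C := fun z => (x₀ z, w₁ z)) (D := fun z => z) (by grind) (by grind) (by grind)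
  linarith

end Chain

/-! ### Uniform laws. -/

/-- Two functions on a finite type inducing the same law are intertwined by a permutation. -/
lemma exists_perm_of_map_uniform_eq {F κ : Type*} [Fintype F] [Nonempty F] {a b : F → κ}
    (h : ∀ q, (PMF.uniformOfFintype F).map a q = (PMF.uniformOfFintype F).map b q) :
    ∃ e : F ≃ F, ∀ f, b (e f) = a f := by
  classical
  have hc : ∀ (c : F → κ) (q : κ), (PMF.uniformOfFintype F).map c q =
      Fintype.card {f // c f = q} * (Fintype.card F : ENNReal)⁻¹ := by
    intro c q
    rw [PMF.map_apply, tsum_fintype, Fintype.card_subtype]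
    simp only [PMF.uniformOfFintype_apply, @eq_comm _ q]
    rw [← sum_filter, sum_const, nsmul_eq_mul]
  have hcard : ∀ q, Fintype.card {f // a f = q} = Fintype.card {f // b f = q} := by
    intro q
    have := h q
    rw [hc a, hc b] at this
    have hne : (Fintype.card F : ENNReal)⁻¹ ≠ 0 := by simp
    have hnt : (Fintype.card F : ENNReal)⁻¹ ≠ ⊤ := by simp
    exact_mod_cast (ENNReal.mul_left_inj hne hnt).1 this
  exact ⟨Equiv.ofFiberEquiv fun q => Fintype.equivOfCardEq (hcard q),
    fun f => Equiv.ofFiberEquiv_map _ f⟩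

lemma uniform_mem_stdSimplex (Ω : Type*) [Fintype Ω] [Nonempty Ω] :
    (fun _ : Ω => (Fintype.card Ω : ℝ)⁻¹) ∈ stdSimplex ℝ Ω :=
  ⟨fun _ => by positivity, by simp⟩

lemma entropy_uniform (Ω : Type*) [Fintype Ω] [Nonempty Ω] :
    entropy (fun _ : Ω => (Fintype.card Ω : ℝ)⁻¹) (fun ω => ω) = Real.log (Fintype.card Ω) := by
  have h : ∀ ω : Ω, levelProb (fun _ : Ω => (Fintype.card Ω : ℝ)⁻¹) (fun ω => ω) ω =
      (Fintype.card Ω : ℝ)⁻¹ := fun ω => by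
    unfold levelProb
    rw [Fintype.sum_eq_single ω fun x hx => if_neg hx, if_pos rfl]
  simp [entropy, h]

/-! ### Application to PIR codes. -/

namespace PIRCode

variable {L : ℕ} {X Y F : Type*} [Fintype F] [Nonempty F] {S Q : Fin 2 → Type*}

/-- The answer of server `n` to the query `q`, as a function of the messages. -/
def reply {N K L : ℕ} {X Y F : Type*} [Fintype F] [Nonempty F] {S Q : Fin N → Type*}
    (C : PIRCode N K L X Y F S Q) (n : Fin N) (q : Q n) (W : Fin K → Fin L → X) :
    Fin (C.len n q) → Y :=
  C.answer n q (C.store n W)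

/-- The queries are variables tied to the key by equations, since one query is reused under
different keys while the type of `decode` depends on the key. -/
lemma message_eq_of_reply_eq (C : PIRCode 2 2 L X Y F S Q) {i j : Fin 2} (hij : i ≠ j)
    (k : Fin 2) {f : F} {q : Q i} {r : Q j}
    (hq : C.query i k f = q) (hr : C.query j k f = r) {W W' : Fin 2 → Fin L → X}
    (h1 : C.reply i q W = C.reply i q W') (h2 : C.reply j r W = C.reply j r W') :
    W k = W' k := by
  subst hq hr
  rw [← C.correct k f W, ← C.correct k f W']
  congr 1
  funext n
  have : n = i ∨ n = j := by omega
  rcases this with rfl | rfl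
  · exact h1
  · exact h2

lemma sum_query_eq (C : PIRCode 2 2 L X Y F S Q) (n k k' : Fin 2) (G : Q n → ℝ) :
    ∑ f, G (C.query n k f) = ∑ f, G (C.query n k' f) := by
  obtain ⟨e, he⟩ := exists_perm_of_map_uniform_eq (C.privacy k k' n)
  rw [← e.sum_comp fun f => G (C.query n k' f)]
  simp only [he]

lemma expectedLength_eq (C : PIRCode 2 2 L X Y F S Q) (n k : Fin 2) :
    C.expectedLength n k = (∑ f, (C.len n (C.query n 0 f) : ℝ)) / Fintype.card F := by
  rw [← C.sum_query_eq n k 0 fun q => (C.len n q : ℝ), sum_div]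
  exact sum_congr rfl fun f _ => by simp [div_eq_inv_mul]

variable [Fintype X]

/-- The uniform law of the messages. -/
noncomputable def messageLaw (L : ℕ) (X : Type*) [Fintype X] : (Fin 2 → Fin L → X) → ℝ :=
  fun _ => (Fintype.card (Fin 2 → Fin L → X) : ℝ)⁻¹

/-- The averaged chain inequality for the ordered pair of servers `(i, j)`. -/
lemma sum_entropy_chain [Nonempty X] (C : PIRCode 2 2 L X Y F S Q) {i j : Fin 2} (hij : i ≠ j) :
    Fintype.card F * (20 * (L * Real.log (Fintype.card X))) +
        ∑ f, entropy (messageLaw L X) (fun W => (C.reply i (C.query i 0 f) W, W 1)) ≤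
      Fintype.card F * (3 * (entropy (messageLaw L X) (C.store i) +
        entropy (messageLaw L X) (C.store j))) +
        ∑ f, entropy (messageLaw L X) (fun W => (C.reply j (C.query j 0 f) W, W 1)) +
        8 * (∑ f, entropy (messageLaw L X) (C.reply i (C.query i 0 f)) +
          ∑ f, entropy (messageLaw L X) (C.reply j (C.query j 0 f))) := by
  set p := messageLaw L X
  have hp : p ∈ stdSimplex ℝ (Fin 2 → Fin L → X) := uniform_mem_stdSimplex _
  have hid : entropy p (fun W => W) = 2 * (L * Real.log (Fintype.card X)) := by
    refine (entropy_uniform (Fin 2 → Fin L → X)).trans ?_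
    simp
  have hsum : 2 * (L * Real.log (Fintype.card X)) ≤
      entropy p (fun W => W 0) + entropy p (fun W => W 1) := by
    rw [← hid]
    refine le_trans (entropy_mono hp.1 fun W W' _ _ h => ?_) (entropy_add_le hp _ _)
    funext k
    fin_cases k
    · exact congrArg Prod.fst h
    · exact congrArg Prod.snd h
  -- `τ` passes to a key that requests the second message with the same query to `j`; `σ.symm`
  -- returns to a key that requests the first with the same query to `i`.
  obtain ⟨σ, hσ⟩ := exists_perm_of_map_uniform_eq (C.privacy 0 1 i)
  obtain ⟨τ, hτ⟩ := exists_perm_of_map_uniform_eq (C.privacy 0 1 j)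
  have hσ' : ∀ f, C.query i 0 (σ.symm f) = C.query i 1 f := fun f => by
    rw [← hσ, Equiv.apply_symm_apply]
  let A : Q i → ℝ := fun q => entropy p (C.reply i q)
  let A₁ : Q i → ℝ := fun q => entropy p (fun W => (C.reply i q W, W 0))
  let A₂ : Q i → ℝ := fun q => entropy p (fun W => (C.reply i q W, W 1))
  let B : Q j → ℝ := fun q => entropy p (C.reply j q)
  let B₂ : Q j → ℝ := fun q => entropy p (fun W => (C.reply j q W, W 1))
  -- The constant is 20 = 9·2 + 2: nine joint entropies of both messages, plus H(W₁) + H(W₂).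
  have key : ∀ f, 20 * (L * Real.log (Fintype.card X)) + A (C.query i 0 f) +
      A₂ (C.query i 1 (τ f)) + 3 * A₁ (C.query i 0 f) + B₂ (C.query j 0 f) ≤
      3 * (entropy p (C.store i) + entropy p (C.store j)) +
      5 * (A (C.query i 0 f) + B (C.query j 0 f)) +
      3 * (A (C.query i 1 (τ f)) + B (C.query j 0 f)) + A (C.query i 1 (τ f)) +
      2 * A₁ (C.query i 1 (τ f)) + A₁ (C.query i 1 (τ (σ.symm (τ f)))) +
      2 * B₂ (C.query j 0 (σ.symm (τ f))) := by
    intro f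
    have h := entropy_chain hp (x₀ := C.reply i (C.query i 0 f))
      (x₂ := C.reply i (C.query i 1 (τ f))) (x₄ := C.reply i (C.query i 1 (τ (σ.symm (τ f)))))
      (y₁ := C.reply j (C.query j 0 f)) (y₃ := C.reply j (C.query j 0 (σ.symm (τ f))))
      (w₁ := fun W => W 0) (w₂ := fun W => W 1) (s := C.store i) (t := C.store j)
      (fun W W' h0 h1 => by funext k; fin_cases k; exacts [h0, h1])
      (fun W W' h => congrArg (C.answer i _) h) (fun W W' h => congrArg (C.answer i _) h)
      (fun W W' h => congrArg (C.answer i _) h) (fun W W' h => congrArg (C.answer j _) h)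
      (fun W W' h => congrArg (C.answer j _) h)
      (fun W W' => C.message_eq_of_reply_eq hij 0 rfl rfl)
      (fun W W' => C.message_eq_of_reply_eq hij 1 rfl (hτ f))
      (fun W W' => C.message_eq_of_reply_eq hij 0 (hσ' _) rfl)
      (fun W W' => C.message_eq_of_reply_eq hij 1 rfl (hτ _))
    have h1 := entropy_add_le hp (C.reply i (C.query i 0 f)) (C.reply j (C.query j 0 f))
    have h2 := entropy_add_le hp (C.reply i (C.query i 1 (τ f))) (C.reply j (C.query j 0 f))
    simp only [A, A₁, A₂, B, B₂]
    linarith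
  have hs := sum_le_sum fun f (_ : f ∈ univ) => key f
  have tA : ∀ G : Q i → ℝ, ∑ f, G (C.query i 1 (τ f)) = ∑ f, G (C.query i 0 f) := fun G =>
    (τ.sum_comp fun f => G (C.query i 1 f)).trans (C.sum_query_eq i 1 0 G)
  have tA' : ∑ f, A₁ (C.query i 1 (τ (σ.symm (τ f)))) = ∑ f, A₁ (C.query i 0 f) :=
    ((τ.trans (σ.symm.trans τ)).sum_comp fun f => A₁ (C.query i 1 f)).trans
      (C.sum_query_eq i 1 0 A₁)
  have tB : ∑ f, B₂ (C.query j 0 (σ.symm (τ f))) = ∑ f, B₂ (C.query j 0 f) :=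
    (τ.trans σ.symm).sum_comp fun f => B₂ (C.query j 0 f)
  -- After reindexing by permutations, `A₁` cancels (3 against 2 + 1), one `B₂` remains on the
  -- right, and `A` and `B` have net coefficient 8.
  simp only [sum_add_distrib, ← mul_sum, sum_const, card_univ, nsmul_eq_mul, tA, tA', tB] at hs
  simp only [A, A₁, A₂, B, B₂] at hs
  linarith

variable [Fintype Y]

lemma sum_entropy_reply_le [Nonempty X] (C : PIRCode 2 2 L X Y F S Q) (n k : Fin 2) :
    ∑ f, entropy (messageLaw L X) (C.reply n (C.query n 0 f)) ≤
      Fintype.card F * (Real.log (Fintype.card Y) * C.expectedLength n k) := by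
  have hF : (Fintype.card F : ℝ) ≠ 0 := by simp
  rw [C.expectedLength_eq, mul_left_comm, mul_div_cancel₀ _ hF, mul_sum]
  refine sum_le_sum fun f _ => (entropy_le_log_card (uniform_mem_stdSimplex _) _).trans ?_
  simp [mul_comm]

lemma log_bound [Nonempty X] [∀ n, Fintype (S n)] (C : PIRCode 2 2 L X Y F S Q) (k : Fin 2) :
    20 * (L * Real.log (Fintype.card X)) ≤
      3 * (Real.log (Fintype.card (S 0)) + Real.log (Fintype.card (S 1))) +
      8 * (Real.log (Fintype.card Y) * C.expectedLength 0 k +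
        Real.log (Fintype.card Y) * C.expectedLength 1 k) := by
  have hp : messageLaw L X ∈ stdSimplex ℝ (Fin 2 → Fin L → X) := uniform_mem_stdSimplex _
  have hF : (0 : ℝ) < Fintype.card F := by simp [Fintype.card_pos]
  -- Adding both orders of the databases cancels the entropies of an answer paired with `W 1`.
  have h1 := C.sum_entropy_chain (i := 0) (j := 1) (by decide)
  have h2 := C.sum_entropy_chain (i := 1) (j := 0) (by decide)
  have e0 := C.sum_entropy_reply_le 0 k
  have e1 := C.sum_entropy_reply_le 1 k
  have s0 := entropy_le_log_card hp (C.store 0)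
  have s1 := entropy_le_log_card hp (C.store 1)
  have s2 := mul_le_mul_of_nonneg_left (add_le_add s0 s1) hF.le
  refine le_of_mul_le_mul_left ?_ hF
  linarith

end PIRCode

theorem theorem3 {L : ℕ} {X Y F : Type*} [Fintype X] [Fintype Y] [Fintype F] [Nonempty F]
    {S Q : Fin 2 → Type*} [∀ n, Fintype (S n)]
    (hL : 0 < L) (hX : 1 < Fintype.card X)
    (C : PIRCode 2 2 L X Y F S Q) (k : Fin 2) :
    3 * C.storageCost + 8 * C.downloadCost k ≥ 10 := by
  have : Nonempty X := Fintype.card_pos_iff.1 (by omega)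
  have hm : 0 < L * Real.log (Fintype.card X) :=
    mul_pos (Nat.cast_pos.2 hL) (Real.log_pos (by exact_mod_cast hX))
  have h2 : Real.log 2 ≠ 0 := (Real.log_pos one_lt_two).ne'
  have e : ∀ a b c : ℝ, Real.log a / Real.log 2 * b / (c * (Real.log (Fintype.card X) / Real.log 2))
      = Real.log a * b / (c * Real.log (Fintype.card X)) := fun a b c => by
    rw [div_mul_eq_mul_div, mul_div_assoc', div_div_div_cancel_right₀ h2]
  have e' : ∀ a c : ℝ, Real.log a / Real.log 2 / (c * (Real.log (Fintype.card X) / Real.log 2))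
      = Real.log a / (c * Real.log (Fintype.card X)) := fun a c => by
    simpa using e a 1 c
  have h := C.log_bound k
  simp only [PIRCode.storageCost, PIRCode.downloadCost, PIRCode.storageCostAt,
    PIRCode.downloadCostAt, Real.logb, Fin.sum_univ_two, e, e', ← add_div]
  rw [ge_iff_le, mul_div_assoc', mul_div_assoc', mul_div_assoc', mul_div_assoc', ← add_div,
    le_div_iff₀ hm]
  push_cast
  linarith
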